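/- Setting. Let $\mathcal G$ be a connected graph on $m\ge 1$ workers, decomposed into $M$ pairwise edge-disjoint matchings with Laplacians $\mathbf L_1,\dots,\mathbf L_M$. Let $p_1,\dots,p_M\in[0,1]$ and $\alpha\in\mathbb R$. In iteration $k$ put $\mathbf W^{(k)}=\mathbf I-\alpha\sum_{j=1}^M B_j^{(k)}\mathbf L_j$ with $B_j^{(k)}\sim\mathrm{Bernoulli}(p_j)$ (the MATCHA mixing matrices), and let $\rho$ be the spectral norm of $\mathbb E[\mathbf W^{(k)\top}\mathbf W^{(k)}]-\frac1m\mathbf 1\mathbf 1^\top$. Worker $i$ has a data distribution $\mathcal D_i$ and the local objective $F_i(x)=\mathbb E_{s\sim\mathcal D_i}[\ell(x;s)]$ on $\mathbb R^d$; let $F=\frac1m\sum_{i=1}^m F_i$. All workers start at $x_i^{(1)}=\overline x^{(1)}$ and iterate $$x_i^{(k+1)}=\sum_{j=1}^m W^{(k)}_{ij}\bigl(x_j^{(k)}-\eta\, g(x_j^{(k)};\xi_j^{(k)})\bigr),\qquad \overline x^{(k)}=\frac1m\sum_{i=1}^m x_i^{(k)},$$ where $\xi_j^{(k)}$ is a mini-batch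 of samples from $\mathcal D_j$, $g$ is the stochastic gradient, and all the $\xi_j^{(k)}$ and $B_j^{(k)}$ are independent. Let $\mathcal F^{(k)}$ be the $\sigma$-algebra generated by the mini-batches and activations of the iterations before $k$. Assumptions. (1) Each $F_i$ is differentiable with $L$-Lipschitz gradient. (2) $\mathbb E[g(x_i^{(k)};\xi_i^{(k)})\mid\mathcal F^{(k)}]=\nabla F_i(x_i^{(k)})$. (3) $\mathbb E[\|g(x_i^{(k)};\xi_i^{(k)})-\nabla F_i(x_i^{(k)})\|^2\mid\mathcal F^{(k)}]\le\sigma^2$. (4) $\frac1m\sum_{i=1}^m\|\nabla F_i(x)-\nabla F(x)\|^2\le\zeta^2$ for all $x$. Moreover $F\ge F_{\inf}$ for some $F_{\inf}\in\mathbb R$. Corollary (linear speedup). For all $L,\sigma,\zeta,\rho,\Delta$ there are constants $C_1,C_2\ge0$, depending on these five numbers only, such that in every such setting with these $L,\sigma,\zeta,\rho$, with $F(\overline x^{(1)})-F_{\inf}\le\Delta$, and with $K\ge1$ and $\eta=\sqrt{m/K}$ satisfying $\eta L\le\min\{1,(\sqrt{\rho^{-1}}-1)/4\}$ (the second bound being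 $+\infty$ if $\rho=0$), the expectations below are finite and $$\frac1K\sum_{k=1}^K\mathbb E\bigl[\|\nabla F(\overline x^{(k)})\|^2\bigr]\le\frac{C_1}{\sqrt{mK}}+C_2\,\frac mK .$$ -/

import Mathlib

open MeasureTheory ProbabilityTheory
open scoped NNReal

noncomputable section

/-- A MATCHA communication scheme on `m` workers with `M` matchings: a connected base graph, its
decomposition into edge-disjoint matchings, the activation probabilities `p j` of the matchings,
and the weight `α` of the consensus step. -/
structure MatchaScheme (m M : ℕ) where
  /-- the base communication graph -/
  base : SimpleGraph (Fin m)
  base_connected : base.Connected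
  /-- the matchings, as spanning subgraphs of the base graph -/
  matching : Fin M → SimpleGraph (Fin m)
  /-- every vertex is incident with at most one edge of each matching -/
  matching_isMatching : ∀ j v, ((matching j).neighborSet v).Subsingleton
  matching_disjoint : ∀ i j, i ≠ j → Disjoint (matching i).edgeSet (matching j).edgeSet
  matching_union : ⨆ j, matching j = base
  /-- the activation probabilities -/
  p : Fin M → ℝ
  p_nonneg : ∀ j, 0 ≤ p j
  p_le_one : ∀ j, p j ≤ 1
  /-- the weight of the neighbours' information -/
  α : ℝ

open Classical in
/-- The Laplacian `∑ j, b j • L_j` of the topology activated by `b`. -/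
def MatchaScheme.laplacian {m M : ℕ} (N : MatchaScheme m M) (b : Fin M → Bool) :
    Matrix (Fin m) (Fin m) ℝ :=
  ∑ j, (if b j = true then (1 : ℝ) else 0) • (N.matching j).lapMatrix ℝ

/-- The mixing matrix `W = I - α ∑ j, b j • L_j`. -/
def MatchaScheme.mixing {m M : ℕ} (N : MatchaScheme m M) (b : Fin M → Bool) :
    Matrix (Fin m) (Fin m) ℝ :=
  1 - N.α • N.laplacian b

/-- The spectral norm (largest singular value) of `E[Wᵀ W] - (1/m) 1 1ᵀ`, where `W` is the mixing
matrix given by the random activations `B` of the matchings. The expectation is entrywise. -/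
def MatchaScheme.spectralNorm {m M : ℕ} (N : MatchaScheme m M) {Ω : Type*} [MeasurableSpace Ω]
    (μ : Measure Ω) (B : Fin M → Ω → Bool) : ℝ :=
  ‖Matrix.toEuclideanCLM (n := Fin m) (𝕜 := ℝ)
    (Matrix.of (fun a c : Fin m =>
      (∫ ω, ((N.mixing (fun j => B j ω)).transpose * N.mixing (fun j => B j ω)) a c ∂μ)
        - 1 / (m : ℝ)))‖

/-- The learning problem: a loss `ℓ(x; s)` and a local data distribution `D i` for each worker. -/
structure LearningProblem (d m : ℕ) (S : Type*) [MeasurableSpace S] where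
  loss : EuclideanSpace ℝ (Fin d) → S → ℝ
  D : Fin m → Measure S
  D_prob : ∀ i, IsProbabilityMeasure (D i)
  loss_integrable : ∀ i x, Integrable (loss x) (D i)

namespace LearningProblem

variable {d m : ℕ} {S : Type*} [MeasurableSpace S]

/-- The local objective `F_i(x) = E_{s ∼ D_i} ℓ(x; s)`. -/
def localObj (P : LearningProblem d m S) (i : Fin m) (x : EuclideanSpace ℝ (Fin d)) : ℝ :=
  ∫ s, P.loss x s ∂(P.D i)

/-- The objective `F(x) = (1/m) ∑ i, F_i(x)`. -/
def obj (P : LearningProblem d m S) (x : EuclideanSpace ℝ (Fin d)) : ℝ :=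
  (1 / (m : ℝ)) * ∑ i, P.localObj i x

/-- Each local objective is differentiable with `L`-Lipschitz gradient. -/
def Smooth (P : LearningProblem d m S) (L : ℝ≥0) : Prop :=
  ∀ i, Differentiable ℝ (P.localObj i) ∧ LipschitzWith L (gradient (P.localObj i))

/-- The deviation of the local gradients from the global one is bounded by `ζ ^ 2`. -/
def BoundedDeviation (P : LearningProblem d m S) (ζ : ℝ) : Prop :=
  ∀ x, (1 / (m : ℝ)) * ∑ i, ‖gradient (P.localObj i) x - gradient P.obj x‖ ^ 2 ≤ ζ ^ 2

end LearningProblem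

/-- The random inputs of a run: for every iteration `k`, a mini-batch `ξ k i` of `b` samples for each
worker `i` and a bit `B k j` activating each matching `j`; together with the stochastic gradient
`g(x; ξ)`, the learning rate `η` and the common initial model `x₁`. Iterations are numbered from
`0`. -/
structure Run (d m M b : ℕ) (S Ω : Type*) where
  g : EuclideanSpace ℝ (Fin d) → (Fin b → S) → EuclideanSpace ℝ (Fin d)
  ξ : ℕ → Fin m → Ω → (Fin b → S)
  B : ℕ → Fin M → Ω → Bool
  η : ℝ
  x₁ : EuclideanSpace ℝ (Fin d)

namespace Run

variable {d m M b : ℕ} {S Ω : Type*}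

/-- The local models: `x_i^(k+1) = ∑ j, W_ij^(k) (x_j^(k) - η g(x_j^(k); ξ_j^(k)))`, all workers
starting from `x₁`. -/
def iterate (R : Run d m M b S Ω) (N : MatchaScheme m M) :
    ℕ → Fin m → Ω → EuclideanSpace ℝ (Fin d)
  | 0, _, _ => R.x₁
  | k + 1, i, ω =>
      ∑ j, N.mixing (fun l => R.B k l ω) i j •
        (R.iterate N k j ω - R.η • R.g (R.iterate N k j ω) (R.ξ k j ω))

/-- The averaged iterate `(1/m) ∑ i, x_i^(k)`. -/
def avgIterate (R : Run d m M b S Ω) (N : MatchaScheme m M) (k : ℕ) (ω : Ω) :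
    EuclideanSpace ℝ (Fin d) :=
  (1 / (m : ℝ)) • ∑ i, R.iterate N k i ω

/-- The stochastic gradient `g(x_i^(k); ξ_i^(k))` computed by worker `i` in iteration `k`. -/
def stochGrad (R : Run d m M b S Ω) (N : MatchaScheme m M) (k : ℕ) (i : Fin m) (ω : Ω) :
    EuclideanSpace ℝ (Fin d) :=
  R.g (R.iterate N k i ω) (R.ξ k i ω)

variable [MeasurableSpace S]

/-- The sigma-algebras generated by the single mini-batches (`inl i`) and the single activation bits
(`inr j`) of all iterations. -/
@[reducible]
def source (R : Run d m M b S Ω) (a : ℕ × (Fin m ⊕ Fin M)) : MeasurableSpace Ω :=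
  match a with
  | (k, Sum.inl i) => MeasurableSpace.comap (R.ξ k i) inferInstance
  | (k, Sum.inr j) => MeasurableSpace.comap (R.B k j) inferInstance

/-- The sigma-algebra generated by the mini-batches and activations of all iterations before
iteration `k`. -/
@[reducible]
def history (R : Run d m M b S Ω) (k : ℕ) : MeasurableSpace Ω :=
  ⨆ a ∈ {a : ℕ × (Fin m ⊕ Fin M) | a.1 < k}, R.source a

variable [MeasurableSpace Ω]

/-- The random inputs are sampled as the algorithm prescribes: the samples of the mini-batch
`ξ k i` come from `D i`, the activation of matching `j` is Bernoulli with parameter `p j`, and all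
mini-batches and all activations, over all workers, matchings and iterations, are independent. -/
structure IsSampled (R : Run d m M b S Ω) (N : MatchaScheme m M) (P : LearningProblem d m S)
    (μ : Measure Ω) : Prop where
  measurable_g : Measurable (fun z : EuclideanSpace ℝ (Fin d) × (Fin b → S) => R.g z.1 z.2)
  measurable_ξ : ∀ k i, Measurable (R.ξ k i)
  measurable_B : ∀ k j, Measurable (R.B k j)
  law_ξ : ∀ k i t, μ.map (fun ω => R.ξ k i ω t) = P.D i
  law_B : ∀ k j, μ.real {ω | R.B k j ω = true} = N.p j
  indep : iIndep R.source μ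

/-- In the first `K` iterations the stochastic gradients are unbiased given the past:
`E[g(x_i^(k); ξ_i^(k)) | history k] = ∇F_i(x_i^(k))`. -/
def Unbiased (R : Run d m M b S Ω) (N : MatchaScheme m M) (P : LearningProblem d m S)
    (μ : Measure Ω) (K : ℕ) : Prop :=
  ∀ k < K, ∀ i, Integrable (R.stochGrad N k i) μ ∧
    μ[R.stochGrad N k i | R.history k] =ᵐ[μ]
      fun ω => gradient (P.localObj i) (R.iterate N k i ω)

/-- In the first `K` iterations the stochastic gradients have conditional variance at most
`σ ^ 2`. -/
def BoundedVariance (R : Run d m M b S Ω) (N : MatchaScheme m M) (P : LearningProblem d m S)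
    (μ : Measure Ω) (K : ℕ) (σ : ℝ) : Prop :=
  ∀ k < K, ∀ i,
    Integrable
      (fun ω => ‖R.stochGrad N k i ω - gradient (P.localObj i) (R.iterate N k i ω)‖ ^ 2) μ ∧
    μ[fun ω => ‖R.stochGrad N k i ω - gradient (P.localObj i) (R.iterate N k i ω)‖ ^ 2
      | R.history k] ≤ᵐ[μ] fun _ => σ ^ 2

end Run

/-- The condition `η L ≤ min {1, (√(ρ⁻¹) - 1) / 4}`, the second bound being void (infinite) if
`ρ = 0`. -/
def LearningRateCondition (η L ρ : ℝ) : Prop :=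
  η * L ≤ 1 ∧ (0 < ρ → η * L ≤ (√(ρ⁻¹) - 1) / 4)

end

/-!
The columns of every mixing matrix sum to one, so mixing leaves the average of the local models
alone: `avgIterate` performs a gradient descent step along the average `ḡ` of the local stochastic
gradients. The descent lemma for the `L`-smooth objective, with `η L ≤ 1`, then gives
`(η/2) E‖∇F(x̄)‖² ≤ E F(x̄) - E F(x̄⁺) + (η L²/2m) E D + (η² L/2) E‖n̄‖²`,
where `D = ∑ i, ‖x_i - x̄‖²` is the consensus error and `n̄` is the average of the gradient errors of
the workers (`Run.IsSampled.integral_descent`). The errors of different workers are uncorrelated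
given the past, because an independent mini-batch of another worker does not spoil unbiasedness
(`condExp_sup_ae_eq_zero`); hence `E‖n̄‖² ≤ σ²/m`, which is where the linear speedup comes from.

The consensus error satisfies a contraction. The activations are independent of the half steps
`y_j`, and `E[Wᵀ W] - (1/m) 1 1ᵀ` has norm `ρ`, so that `E D⁺ ≤ ρ E ∑ j, ‖y_j - c‖²` for every point
`c` known before the mini-batches are drawn
(`Run.IsSampled.integral_consensusError_succ_le`). The choice `c = x̄ - η ∇F(x̄)` removes the global
gradient, and what remains of `y_j - c` is a vector of norm at most `(1 + η L) ‖x_j - x̄‖`, the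
heterogeneity bounded by `ζ`, and the noise bounded by `σ`. The learning rate condition gives
`√ρ (1 + η L) ≤ r` for `r = (1 + 3√ρ)/4`, which is less than one for `ρ < 1`. Therefore `E D ≤ C η² m`
with `C` depending on `ρ`, `σ`, `ζ` only. Telescoping the descent inequality and inserting
`η = √(m/K)` gives the claim.

For `ρ ≥ 1` the learning rate condition forces `L = 0`; then the objective is affine and bounded
below, and its gradient vanishes.
-/

noncomputable section

/-! ### Smooth functions -/

/-- The descent lemma: a function with `L`-Lipschitz gradient lies below its quadratic model. -/
theorem le_add_inner_add_of_lipschitzWith_gradient {E : Type*} [NormedAddCommGroup E]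
    [InnerProductSpace ℝ E] [CompleteSpace E] {f : E → ℝ} {L : ℝ≥0} (hf : Differentiable ℝ f)
    (hL : LipschitzWith L (gradient f)) (x v : E) :
    f (x + v) ≤ f x + inner ℝ (gradient f x) v + L / 2 * ‖v‖ ^ 2 := by
  let φ : ℝ → ℝ := fun t => f (x + t • v) - t * inner ℝ (gradient f x) v - L / 2 * t ^ 2 * ‖v‖ ^ 2
  have hφ : ∀ t, HasDerivAt φ (inner ℝ (gradient f (x + t • v)) v - inner ℝ (gradient f x) v
      - L * t * ‖v‖ ^ 2) t := by
    intro t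
    have h1 : HasDerivAt (fun t : ℝ => x + t • v) v t := by
      simpa using ((hasDerivAt_id t).smul_const v).const_add x
    have h2 := (hf (x + t • v)).hasFDerivAt.comp_hasDerivAt t h1
    rw [← inner_gradient_left] at h2
    have h3 := (hasDerivAt_id t).mul_const (inner ℝ (gradient f x) v)
    have h4 := (((hasDerivAt_id t).pow 2).const_mul ((L : ℝ) / 2)).mul_const (‖v‖ ^ 2)
    refine ((h2.sub h3).sub h4).congr_deriv ?_
    simp only [id_eq, Nat.cast_ofNat]
    ring
  have hanti : AntitoneOn φ (Set.Icc 0 1) := by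
    refine antitoneOn_of_deriv_nonpos (convex_Icc 0 1)
      (fun t _ => (hφ t).continuousAt.continuousWithinAt)
      (fun t _ => (hφ t).differentiableAt.differentiableWithinAt) fun t ht => ?_
    rw [interior_Icc] at ht
    rw [(hφ t).deriv, ← inner_sub_left]
    have h5 := real_inner_le_norm (gradient f (x + t • v) - gradient f x) v
    have h6 := hL.norm_sub_le (x + t • v) x
    rw [add_sub_cancel_left, norm_smul, Real.norm_of_nonneg ht.1.le] at h6
    nlinarith [norm_nonneg v, mul_le_mul_of_nonneg_right h6 (norm_nonneg v)]
  have := hanti (Set.left_mem_Icc.2 zero_le_one) (Set.right_mem_Icc.2 zero_le_one) zero_le_one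
  simp only [φ, one_smul, zero_smul, add_zero] at this
  linarith

/-- An affine function that is bounded below has zero gradient: the step along `-∇f x` chosen here
would decrease `f` to `c - 1`. -/
theorem gradient_eq_zero_of_lipschitzWith_zero {E : Type*} [NormedAddCommGroup E]
    [InnerProductSpace ℝ E] [CompleteSpace E] {f : E → ℝ} (hf : Differentiable ℝ f)
    (hL : LipschitzWith 0 (gradient f)) {c : ℝ} (hc : ∀ x, c ≤ f x) (x : E) :
    gradient f x = 0 := by
  by_contra h
  have hpos : 0 < ‖gradient f x‖ ^ 2 := by positivity
  have h1 := le_add_inner_add_of_lipschitzWith_gradient hf hL x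
    (-((f x - c + 1) / ‖gradient f x‖ ^ 2) • gradient f x)
  rw [inner_smul_right, real_inner_self_eq_norm_sq, neg_mul, div_mul_cancel₀ _ hpos.ne'] at h1
  have h2 := hc (x + -((f x - c + 1) / ‖gradient f x‖ ^ 2) • gradient f x)
  simp at h1 h2
  linarith

theorem norm_sq_average_le {E : Type*} [NormedAddCommGroup E] [NormedSpace ℝ E] {m : ℕ}
    (v : Fin m → E) : ‖(1 / (m : ℝ)) • ∑ i, v i‖ ^ 2 ≤ (1 / (m : ℝ)) * ∑ i, ‖v i‖ ^ 2 := by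
  rcases Nat.eq_zero_or_pos m with rfl | hm
  · simp
  have hm' : (0 : ℝ) < m := by exact_mod_cast hm
  have h1 : ‖∑ i, v i‖ ^ 2 ≤ m * ∑ i, ‖v i‖ ^ 2 := by
    have h2 := sq_sum_le_card_mul_sum_sq (s := Finset.univ) (f := fun i => ‖v i‖)
    rw [Finset.card_univ, Fintype.card_fin] at h2
    exact (pow_le_pow_left₀ (norm_nonneg _) (norm_sum_le _ _) 2).trans h2
  rw [norm_smul, mul_pow, Real.norm_of_nonneg (by positivity)]
  calc (1 / (m : ℝ)) ^ 2 * ‖∑ i, v i‖ ^ 2 ≤ (1 / (m : ℝ)) ^ 2 * (m * ∑ i, ‖v i‖ ^ 2) := by gcongr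
    _ = _ := by field_simp

namespace LearningProblem

variable {d m : ℕ} {S : Type*} [MeasurableSpace S] {P : LearningProblem d m S} {L : ℝ≥0}

theorem Smooth.hasGradientAt_obj (h : P.Smooth L) (x : EuclideanSpace ℝ (Fin d)) :
    HasGradientAt P.obj ((1 / (m : ℝ)) • ∑ i, gradient (P.localObj i) x) x := by
  rw [hasGradientAt_iff_hasFDerivAt]
  have h1 : HasFDerivAt P.obj ((1 / (m : ℝ)) • ∑ i, fderiv ℝ (P.localObj i) x) x :=
    (HasFDerivAt.fun_sum fun i _ => ((h i).1 x).hasFDerivAt).const_mul _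
  refine h1.congr_fderiv ?_
  simp [toDual_gradient]

theorem Smooth.gradient_obj (h : P.Smooth L) (x : EuclideanSpace ℝ (Fin d)) :
    gradient P.obj x = (1 / (m : ℝ)) • ∑ i, gradient (P.localObj i) x :=
  (h.hasGradientAt_obj x).gradient

theorem Smooth.differentiable_obj (h : P.Smooth L) : Differentiable ℝ P.obj :=
  fun x => (h.hasGradientAt_obj x).differentiableAt

/-- Replacing the common point by individual points `y i` changes the average of the local gradients
by at most `L` times the root mean square displacement. -/
theorem Smooth.norm_average_gradient_sub_sq_le (h : P.Smooth L)
    (x : EuclideanSpace ℝ (Fin d)) (y : Fin m → EuclideanSpace ℝ (Fin d)) :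
    ‖gradient P.obj x - (1 / (m : ℝ)) • ∑ i, gradient (P.localObj i) (y i)‖ ^ 2
      ≤ L ^ 2 * ((1 / (m : ℝ)) * ∑ i, ‖y i - x‖ ^ 2) := by
  rw [h.gradient_obj, ← smul_sub, ← Finset.sum_sub_distrib]
  refine (norm_sq_average_le _).trans ?_
  rw [mul_left_comm, Finset.mul_sum (f := fun i => ‖y i - x‖ ^ 2)]
  gcongr with i
  rw [← mul_pow, norm_sub_rev (y i)]
  gcongr
  exact (h i).2.norm_sub_le _ _

theorem Smooth.lipschitzWith_gradient_obj (h : P.Smooth L) :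
    LipschitzWith L (gradient P.obj) := by
  refine LipschitzWith.of_dist_le_mul fun x y => ?_
  rw [dist_eq_norm, dist_eq_norm]
  have h1 := h.norm_average_gradient_sub_sq_le x fun _ => y
  rw [← h.gradient_obj] at h1
  refine abs_le_of_sq_le_sq' (h1.trans ?_) (by positivity) |>.2
  rcases Nat.eq_zero_or_pos m with rfl | hm
  · simp; positivity
  have hm' : (m : ℝ) ≠ 0 := by exact_mod_cast hm.ne'
  simp [norm_sub_rev y x, mul_pow, hm']

end LearningProblem

/-! ### Mixing matrices -/

namespace MatchaScheme

variable {m M : ℕ} (N : MatchaScheme m M)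

theorem laplacian_isSymm (b : Fin M → Bool) : (N.laplacian b).IsSymm := by
  classical
  unfold laplacian Matrix.IsSymm
  rw [Matrix.transpose_sum]
  refine Finset.sum_congr rfl fun j _ => ?_
  rw [Matrix.transpose_smul, SimpleGraph.isSymm_lapMatrix]

theorem sum_laplacian_row (b : Fin M → Bool) (i : Fin m) : ∑ j, N.laplacian b i j = 0 := by
  classical
  unfold laplacian
  simp only [Matrix.sum_apply, Matrix.smul_apply]
  rw [Finset.sum_comm]
  refine Finset.sum_eq_zero fun j _ => ?_
  rw [← Finset.smul_sum]
  have := congrFun ((N.matching j).lapMatrix_mulVec_const_eq_zero (R := ℝ)) i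
  simp only [Matrix.mulVec, dotProduct, Pi.zero_apply, mul_one] at this
  convert smul_zero _

theorem mixing_transpose (b : Fin M → Bool) : (N.mixing b).transpose = N.mixing b := by
  simp [mixing, Matrix.transpose_sub, (N.laplacian_isSymm b).eq]

theorem sum_mixing_row (b : Fin M → Bool) (i : Fin m) : ∑ j, N.mixing b i j = 1 := by
  simp [mixing, Matrix.one_apply, ← Finset.mul_sum, N.sum_laplacian_row b i]

theorem sum_mixing_col (b : Fin M → Bool) (j : Fin m) : ∑ i, N.mixing b i j = 1 := by
  rw [← N.sum_mixing_row b j]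
  refine Finset.sum_congr rfl fun i _ => ?_
  exact (congrFun (congrFun (N.mixing_transpose b) j) i)

theorem pos_workers {m M : ℕ} (N : MatchaScheme m M) : 0 < m := by
  obtain ⟨v⟩ := N.base_connected.nonempty
  exact v.pos

end MatchaScheme

/-- The operator norm bounds the quadratic form of `A` on vector-valued arguments: the form splits
into one scalar quadratic form for each coordinate. -/
theorem sum_sum_mul_inner_le {m d : ℕ} (A : Matrix (Fin m) (Fin m) ℝ)
    (z : Fin m → EuclideanSpace ℝ (Fin d)) :
    ∑ j, ∑ l, A j l * inner ℝ (z j) (z l)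
      ≤ ‖Matrix.toEuclideanCLM (n := Fin m) (𝕜 := ℝ) A‖ * ∑ j, ‖z j‖ ^ 2 := by
  let u : Fin d → EuclideanSpace ℝ (Fin m) := fun t => WithLp.toLp 2 fun j => z j t
  have h1 : ∑ j, ∑ l, A j l * inner ℝ (z j) (z l)
      = ∑ t, inner ℝ (u t) (Matrix.toEuclideanCLM (n := Fin m) (𝕜 := ℝ) A (u t)) := by
    simp only [PiLp.inner_apply, Finset.mul_sum, u, RCLike.inner_apply, conj_trivial,
      Matrix.ofLp_toEuclideanCLM, Matrix.mulVec, dotProduct, Finset.sum_mul]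
    rw [Finset.sum_comm (s := (Finset.univ : Finset (Fin d)))]
    refine Finset.sum_congr rfl fun j _ => ?_
    rw [Finset.sum_comm]
    refine Finset.sum_congr rfl fun t _ => Finset.sum_congr rfl fun l _ => ?_
    ring
  have h2 : ∑ j, ‖z j‖ ^ 2 = ∑ t, ‖u t‖ ^ 2 := by
    simp only [EuclideanSpace.norm_sq_eq, u]
    rw [Finset.sum_comm]
  rw [h1, h2, Finset.mul_sum]
  refine Finset.sum_le_sum fun t _ => ?_
  calc _ ≤ ‖u t‖ * (‖Matrix.toEuclideanCLM (n := Fin m) (𝕜 := ℝ) A‖ * ‖u t‖) :=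
        (real_inner_le_norm _ _).trans (by gcongr; exact ContinuousLinearMap.le_opNorm _ _)
    _ = _ := by ring

/-- After mixing by `W`, the squared deviation from the average is the quadratic form of
`Wᵀ W - (1/m) 1 1ᵀ`. This matrix annihilates the constant vectors, so that an arbitrary reference
point `c` may be subtracted. -/
theorem sum_norm_sq_sum_smul_sub_average {E : Type*} [NormedAddCommGroup E]
    [InnerProductSpace ℝ E] {m : ℕ} (hm : 0 < m) {W : Matrix (Fin m) (Fin m) ℝ}
    (hrow : ∀ i, ∑ j, W i j = 1) (hcol : ∀ j, ∑ i, W i j = 1) (y : Fin m → E) (c : E) :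
    ∑ i, ‖∑ j, W i j • y j - (1 / (m : ℝ)) • ∑ j, y j‖ ^ 2
      = ∑ j, ∑ l, ((W.transpose * W) j l - 1 / (m : ℝ)) * inner ℝ (y j - c) (y l - c) := by
  have hm' : (m : ℝ) ≠ 0 := by exact_mod_cast hm.ne'
  have h1 : ∀ i, ∑ j, W i j • y j - (1 / (m : ℝ)) • ∑ j, y j
      = ∑ j, (W i j - 1 / (m : ℝ)) • (y j - c) := by
    intro i
    simp only [smul_sub, sub_smul, Finset.sum_sub_distrib, ← Finset.sum_smul, hrow i,
      ← Finset.smul_sum]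
    simp [hm', Finset.sum_const, ← Nat.cast_smul_eq_nsmul ℝ]
  have h2 : ∀ j l, (W.transpose * W) j l - 1 / (m : ℝ)
      = ∑ i, (W i j - 1 / (m : ℝ)) * (W i l - 1 / (m : ℝ)) := by
    intro j l
    simp only [sub_mul, mul_sub, Finset.sum_sub_distrib, ← Finset.sum_mul, ← Finset.mul_sum, hcol,
      Matrix.mul_apply, Matrix.transpose_apply]
    simp
    field_simp
    ring
  simp_rw [h1, h2, ← real_inner_self_eq_norm_sq, sum_inner, inner_sum, inner_smul_left,
    inner_smul_right, Finset.sum_mul]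
  rw [Finset.sum_comm]
  refine Finset.sum_congr rfl fun j _ => ?_
  rw [Finset.sum_comm]
  refine Finset.sum_congr rfl fun l _ => Finset.sum_congr rfl fun i _ => ?_
  simp
  ring

/-! ### Conditional expectations and independence -/

section Probability

variable {Ω E : Type*} {m₀ : MeasurableSpace Ω} {μ : Measure Ω}
  [NormedAddCommGroup E] [InnerProductSpace ℝ E]

theorem integrable_inner_of_memLp_two {f g : Ω → E} (hf : MemLp f 2 μ) (hg : MemLp g 2 μ) :
    Integrable (fun ω => inner ℝ (f ω) (g ω)) μ := by
  refine (hf.norm.integrable_mul hg.norm).mono (hf.1.inner hg.1) (.of_forall fun ω => ?_)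
  simpa using norm_inner_le_norm (𝕜 := ℝ) (f ω) (g ω)

variable [CompleteSpace E]

theorem integral_inner_eq_zero_of_condExp_eq_zero {H : MeasurableSpace Ω}
    [IsFiniteMeasure μ] (hH : H ≤ m₀) {a n : Ω → E} (ha : StronglyMeasurable[H] a)
    (ha2 : MemLp a 2 μ) (hn2 : MemLp n 2 μ) (hn : μ[n | H] =ᵐ[μ] 0) :
    ∫ ω, inner ℝ (a ω) (n ω) ∂μ = 0 := by
  have h1 := condExp_bilin_of_stronglyMeasurable_left (innerSL ℝ (E := E)) ha
    (integrable_inner_of_memLp_two ha2 hn2) (hn2.integrable (by norm_num))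
  rw [← integral_condExp hH]
  refine integral_eq_zero_of_ae (h1.trans ?_)
  filter_upwards [hn] with ω hω
  simp [hω]

/-- Enlarging the conditioning σ-algebra by an independent one preserves a vanishing conditional
expectation. Independence is required of `m₃`, which knows both `H` and `f`. -/
theorem condExp_sup_ae_eq_zero {H m₂ m₃ : MeasurableSpace Ω} [IsProbabilityMeasure μ]
    (hH : H ≤ m₃) (h₃ : m₃ ≤ m₀) (h₂ : m₂ ≤ m₀) (hind : Indep m₃ m₂ μ) {f : Ω → E}
    (hf : Integrable f μ) (hfm : StronglyMeasurable[m₃] f) (h0 : μ[f | H] =ᵐ[μ] 0) :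
    μ[f | H ⊔ m₂] =ᵐ[μ] 0 := by
  have hH0 : H ≤ m₀ := hH.trans h₃
  have hle : H ⊔ m₂ ≤ m₀ := sup_le hH0 h₂
  let S : Set (Set Ω) := {s | ∃ A C, MeasurableSet[H] A ∧ MeasurableSet[m₂] C ∧ s = A ∩ C}
  have hgen : H ⊔ m₂ = MeasurableSpace.generateFrom S := by
    refine le_antisymm (sup_le ?_ ?_) (MeasurableSpace.generateFrom_le ?_)
    · exact fun s hs => MeasurableSpace.measurableSet_generateFrom
        ⟨s, Set.univ, hs, MeasurableSet.univ, by simp⟩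
    · exact fun s hs => MeasurableSpace.measurableSet_generateFrom
        ⟨Set.univ, s, MeasurableSet.univ, hs, by simp⟩
    · rintro s ⟨A, C, hA, hC, rfl⟩
      exact MeasurableSet.inter ((le_sup_left : H ≤ H ⊔ m₂) A hA)
        ((le_sup_right : m₂ ≤ H ⊔ m₂) C hC)
  have hpi : IsPiSystem S := by
    rintro s ⟨A, C, hA, hC, rfl⟩ t ⟨A', C', hA', hC', rfl⟩ -
    exact ⟨A ∩ A', C ∩ C', hA.inter hA', hC.inter hC', Set.inter_inter_inter_comm _ _ _ _⟩
  have hA0 : ∀ A, MeasurableSet[H] A → ∫ ω in A, f ω ∂μ = 0 := by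
    intro A hA
    rw [← setIntegral_condExp hH0 hf hA]
    exact integral_eq_zero_of_ae (ae_restrict_of_ae h0)
  have huniv : ∫ ω, f ω ∂μ = 0 := by simpa using hA0 Set.univ MeasurableSet.univ
  have key : ∀ s, MeasurableSet[H ⊔ m₂] s → ∫ ω in s, f ω ∂μ = 0 := by
    refine MeasurableSpace.induction_on_inter hgen hpi (by simp) ?_ ?_ ?_
    · rintro s ⟨A, C, hA, hC, rfl⟩
      -- the conditional expectation of `f` on `A` given the independent `m₂` is constant
      have h1 := condExp_indep_eq h₃ h₂ (hfm.indicator (hH A hA)) hind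
      rw [Set.inter_comm, ← setIntegral_indicator (hH0 A hA),
        ← setIntegral_condExp h₂ (hf.indicator (hH0 A hA)) hC]
      refine integral_eq_zero_of_ae (ae_restrict_of_ae (h1.trans ?_))
      rw [integral_indicator (hH0 A hA), hA0 A hA]
      rfl
    · intro t ht h
      have := integral_add_compl (hle t ht) hf
      rwa [h, huniv, zero_add] at this
    · intro g hd hg h
      rw [integral_iUnion (fun i => hle _ (hg i)) hd hf.integrableOn]
      simp [h]
  refine (ae_eq_condExp_of_forall_setIntegral_eq hle hf
    (fun s _ _ => (integrable_zero _ _ _).integrableOn) (fun s hs _ => ?_)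
    stronglyMeasurable_zero.aestronglyMeasurable).symm
  simp [key s hs]

end Probability

/-! ### Independence and measurability in a run -/

namespace Run

variable {d m M b : ℕ} {S Ω : Type*} [MeasurableSpace S] {R : Run d m M b S Ω}
  {N : MatchaScheme m M}

theorem source_le_history {k : ℕ} {a : ℕ × (Fin m ⊕ Fin M)} (h : a.1 < k) :
    R.source a ≤ R.history k :=
  le_iSup₂ (f := fun a (_ : a ∈ {a : ℕ × (Fin m ⊕ Fin M) | a.1 < k}) => R.source a) a h

theorem history_mono {k l : ℕ} (h : k ≤ l) : R.history k ≤ R.history l :=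
  iSup₂_le fun _ ha => source_le_history (lt_of_lt_of_le ha h)

/-- The σ-algebra of what is known in iteration `k` after the mini-batches are drawn and before the
matchings are activated. -/
@[reducible]
def preMixing (R : Run d m M b S Ω) (k : ℕ) : MeasurableSpace Ω :=
  ⨆ a ∈ {a : ℕ × (Fin m ⊕ Fin M) | a.1 < k ∨ ∃ i, a = (k, Sum.inl i)}, R.source a

theorem history_le_preMixing (k : ℕ) : R.history k ≤ R.preMixing k :=
  biSup_mono fun _ ha => Or.inl ha

theorem source_le_preMixing (k : ℕ) (i : Fin m) : R.source (k, Sum.inl i) ≤ R.preMixing k :=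
  le_iSup₂ (f := fun a (_ : a ∈ {a : ℕ × (Fin m ⊕ Fin M) | a.1 < k ∨ ∃ i, a = (k, Sum.inl i)}) =>
    R.source a) (k, Sum.inl i) (Or.inr ⟨i, rfl⟩)

theorem measurable_g_comp
    (hg : Measurable fun z : EuclideanSpace ℝ (Fin d) × (Fin b → S) => R.g z.1 z.2)
    {m' : MeasurableSpace Ω} {k : ℕ} {i : Fin m} {x : Ω → EuclideanSpace ℝ (Fin d)}
    (hx : Measurable x) (hs : R.source (k, Sum.inl i) ≤ m') :
    Measurable (fun ω => R.g (x ω) (R.ξ k i ω)) :=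
  hg.comp (hx.prodMk (measurable_iff_comap_le.2 hs))

section

variable [MeasurableSpace Ω] {μ : Measure Ω} {P : LearningProblem d m S}

theorem IsSampled.source_le (h : R.IsSampled N P μ) (a : ℕ × (Fin m ⊕ Fin M)) :
    R.source a ≤ ‹MeasurableSpace Ω› := by
  rcases a with ⟨k, i | j⟩
  · exact (h.measurable_ξ k i).comap_le
  · exact (h.measurable_B k j).comap_le

theorem IsSampled.history_le (h : R.IsSampled N P μ) (k : ℕ) :
    R.history k ≤ ‹MeasurableSpace Ω› := iSup₂_le fun a _ => h.source_le a

theorem IsSampled.preMixing_le (h : R.IsSampled N P μ) (k : ℕ) :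
    R.preMixing k ≤ ‹MeasurableSpace Ω› := iSup₂_le fun a _ => h.source_le a

theorem IsSampled.measurable_iterate (h : R.IsSampled N P μ) (k : ℕ) (i : Fin m) :
    Measurable[R.history k] (R.iterate N k i) := by
  induction k generalizing i with
  | zero => exact measurable_const
  | succ k ih =>
    have hB : Measurable[R.history (k + 1)] (fun ω l => R.B k l ω) :=
      @measurable_pi_lambda _ _ _ (R.history (k + 1)) _ _ fun l =>
        measurable_iff_comap_le.2 (source_le_history (R := R) (a := (k, Sum.inr l))
          (Nat.lt_succ_self k))
    change Measurable[R.history (k + 1)] (fun ω => ∑ j, N.mixing (fun l => R.B k l ω) i j •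
      (R.iterate N k j ω - R.η • R.g (R.iterate N k j ω) (R.ξ k j ω)))
    refine Finset.measurable_fun_sum _ fun j _ => ?_
    have hx : Measurable[R.history (k + 1)] (R.iterate N k j) :=
      (ih j).mono (history_mono k.le_succ) le_rfl
    have hW : Measurable[R.history (k + 1)] (fun ω => N.mixing (fun l => R.B k l ω) i j) :=
      (measurable_of_countable fun b : Fin M → Bool => N.mixing b i j).comp hB
    exact hW.smul (hx.sub ((measurable_g_comp h.measurable_g hx
      (source_le_history (Nat.lt_succ_self k))).const_smul R.η))

theorem IsSampled.measurable_stochGrad (h : R.IsSampled N P μ) (k : ℕ) (i : Fin m) :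
    Measurable[R.history k ⊔ R.source (k, Sum.inl i)] (R.stochGrad N k i) :=
  measurable_g_comp h.measurable_g ((h.measurable_iterate k i).mono le_sup_left le_rfl) le_sup_right

theorem IsSampled.indep_stochGrad [IsProbabilityMeasure μ] (h : R.IsSampled N P μ) (k : ℕ)
    {i j : Fin m} (hij : i ≠ j) :
    Indep (R.history k ⊔ R.source (k, Sum.inl j)) (R.source (k, Sum.inl i)) μ := by
  have hT : Disjoint ({a : ℕ × (Fin m ⊕ Fin M) | a.1 < k} ∪ {(k, Sum.inl j)}) {(k, Sum.inl i)} := by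
    simp [hij]
  have := indep_iSup_of_disjoint h.source_le h.indep hT
  rwa [iSup_union, iSup_singleton, iSup_singleton] at this

theorem IsSampled.indep_preMixing_B [IsProbabilityMeasure μ] (h : R.IsSampled N P μ) (k : ℕ) :
    Indep (R.preMixing k) (MeasurableSpace.comap (fun ω l => R.B k l ω) inferInstance) μ := by
  have hT : Disjoint {a : ℕ × (Fin m ⊕ Fin M) | a.1 < k ∨ ∃ i, a = (k, Sum.inl i)}
      {a | ∃ l, a = (k, Sum.inr l)} := by
    rw [Set.disjoint_left]
    rintro a (ha | ⟨i, rfl⟩) ⟨l, hl⟩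
    · subst hl; exact lt_irrefl _ ha
    · simp at hl
  refine indep_of_indep_of_le_right (indep_iSup_of_disjoint h.source_le h.indep hT) ?_
  refine measurable_iff_comap_le.1 (@measurable_pi_lambda _ _ _ (_) _ _ fun l =>
    measurable_iff_comap_le.2 ?_)
  exact le_iSup₂ (f := fun a (_ : a ∈ {a : ℕ × (Fin m ⊕ Fin M) | ∃ l, a = (k, Sum.inr l)}) =>
    R.source a) (k, Sum.inr l) ⟨l, rfl⟩

theorem IsSampled.iIndepFun_B (h : R.IsSampled N P μ) (k : ℕ) : iIndepFun (R.B k) μ := by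
  have hinj : Function.Injective (fun l : Fin M => ((k, Sum.inr l) : ℕ × (Fin m ⊕ Fin M))) :=
    fun a b hab => by simpa using hab
  exact (h.indep.precomp hinj :)

theorem IsSampled.measurable_B_pi (h : R.IsSampled N P μ) (k : ℕ) :
    Measurable (fun ω l => R.B k l ω) := measurable_pi_lambda _ fun l => h.measurable_B k l

/-- The activations of all iterations have the same joint law, the product of the Bernoulli laws. -/
theorem IsSampled.map_B_eq [IsProbabilityMeasure μ] (h : R.IsSampled N P μ) (k : ℕ) :
    μ.map (fun ω l => R.B k l ω) = μ.map (fun ω l => R.B 0 l ω) := by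
  rw [(iIndepFun_iff_map_fun_eq_pi_map fun l => (h.measurable_B k l).aemeasurable).1
      (h.iIndepFun_B k),
    (iIndepFun_iff_map_fun_eq_pi_map fun l => (h.measurable_B 0 l).aemeasurable).1
      (h.iIndepFun_B 0)]
  congr 1
  funext l
  have hp : ∀ k, IsProbabilityMeasure (μ.map (R.B k l)) := fun k =>
    Measure.isProbabilityMeasure_map (h.measurable_B k l).aemeasurable
  have ht : ∀ k, (μ.map (R.B k l)).real {true} = N.p l := fun k => by
    rw [map_measureReal_apply (h.measurable_B k l) (measurableSet_singleton _), ← h.law_B k l]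
    rfl
  have hf : ∀ k, (μ.map (R.B k l)).real {false} = 1 - N.p l := fun k => by
    rw [← ht k, ← probReal_compl_eq_one_sub (measurableSet_singleton _)]
    congr 1
    ext b; cases b <;> simp
  refine Measure.ext_of_singleton fun b => ?_
  rw [← ENNReal.toReal_eq_toReal_iff' (measure_ne_top _ _) (measure_ne_top _ _)]
  cases b
  · exact (hf k).trans (hf 0).symm
  · exact (ht k).trans (ht 0).symm

theorem IsSampled.integral_comp_B [IsProbabilityMeasure μ] (h : R.IsSampled N P μ) (k : ℕ)
    (φ : (Fin M → Bool) → ℝ) :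
    ∫ ω, φ (fun l => R.B k l ω) ∂μ = ∫ ω, φ (fun l => R.B 0 l ω) ∂μ := by
  have hφ : ∀ ν : Measure (Fin M → Bool), AEStronglyMeasurable φ ν := fun ν =>
    (measurable_of_countable φ).aestronglyMeasurable
  rw [← integral_map (h.measurable_B_pi k).aemeasurable (hφ _), h.map_B_eq k,
    integral_map (h.measurable_B_pi 0).aemeasurable (hφ _)]

theorem IsSampled.indepFun_comp_B [IsProbabilityMeasure μ] (h : R.IsSampled N P μ) (k : ℕ)
    (φ : (Fin M → Bool) → ℝ) {f : Ω → ℝ} (hf : Measurable[R.preMixing k] f) :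
    IndepFun (fun ω => φ fun l => R.B k l ω) f μ := by
  have h1 : IndepFun (fun ω l => R.B k l ω) f μ := by
    rw [IndepFun_iff_Indep]
    exact indep_of_indep_of_le_right (h.indep_preMixing_B k).symm (measurable_iff_comap_le.1 hf)
  exact h1.comp (measurable_of_countable φ) measurable_id

theorem IsSampled.integral_comp_B_mul [IsProbabilityMeasure μ] (h : R.IsSampled N P μ) (k : ℕ)
    (φ : (Fin M → Bool) → ℝ) {f : Ω → ℝ} (hf : Measurable[R.preMixing k] f) :
    ∫ ω, φ (fun l => R.B k l ω) * f ω ∂μ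
      = (∫ ω, φ (fun l => R.B 0 l ω) ∂μ) * ∫ ω, f ω ∂μ := by
  rw [← h.integral_comp_B k]
  exact (h.indepFun_comp_B k φ hf).integral_mul_eq_mul_integral
    ((measurable_of_countable φ).comp (h.measurable_B_pi k)).aestronglyMeasurable
    (hf.mono (h.preMixing_le k) le_rfl).aestronglyMeasurable

end

end Run

/-! ### Square integrability of the iterates and the gradient noise -/

theorem LipschitzWith.comp_memLp_of_isFiniteMeasure {Ω E F : Type*} [MeasurableSpace Ω]
    {μ : Measure Ω} [IsFiniteMeasure μ] [NormedAddCommGroup E] [NormedAddCommGroup F] {L : ℝ≥0}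
    {G : E → F} (hG : LipschitzWith L G) {x : Ω → E} (hx : MemLp x 2 μ) :
    MemLp (fun ω => G (x ω)) 2 μ := by
  have h1 : LipschitzWith L (fun y => G y - G 0) :=
    LipschitzWith.of_dist_le_mul fun y z => by simpa using hG.dist_le_mul y z
  have h2 := (h1.comp_memLp (by simp) hx).add (memLp_const (G 0))
  convert h2 using 1
  funext ω
  simp

/-- A function with Lipschitz gradient that is bounded below grows at most quadratically. -/
theorem integrable_comp_of_lipschitzWith_gradient {Ω E : Type*} [MeasurableSpace Ω]
    {μ : Measure Ω} [IsFiniteMeasure μ] [NormedAddCommGroup E] [InnerProductSpace ℝ E]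
    [CompleteSpace E] {f : E → ℝ} {L : ℝ≥0} (hf : Differentiable ℝ f)
    (hL : LipschitzWith L (gradient f)) {c : ℝ} (hc : ∀ x, c ≤ f x) {x : Ω → E}
    (hx : MemLp x 2 μ) : Integrable (fun ω => f (x ω)) μ := by
  have h2 : Integrable (fun ω => ‖x ω‖ ^ 2) μ := (memLp_two_iff_integrable_sq_norm hx.1).1 hx
  have h1 : Integrable (fun ω => inner ℝ (gradient f 0) (x ω)) μ :=
    (hx.const_inner (𝕜 := ℝ) (gradient f 0)).integrable (by norm_num)
  refine integrable_of_le_of_le (hf.continuous.comp_aestronglyMeasurable hx.1)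
    (g₁ := fun _ => c) (g₂ := fun ω => f 0 + inner ℝ (gradient f 0) (x ω) + L / 2 * ‖x ω‖ ^ 2)
    (.of_forall fun ω => hc _) (.of_forall fun ω => ?_) (integrable_const _)
    (((integrable_const _).add h1).add (h2.const_mul _))
  simpa using le_add_inner_add_of_lipschitzWith_gradient hf hL 0 (x ω)

namespace Run

variable {d m M b : ℕ} {S Ω : Type*} {R : Run d m M b S Ω} {N : MatchaScheme m M}

/-- The local model of worker `i` after its gradient step and before the mixing. -/
def halfStep (R : Run d m M b S Ω) (N : MatchaScheme m M) (k : ℕ) (i : Fin m) (ω : Ω) :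
    EuclideanSpace ℝ (Fin d) :=
  R.iterate N k i ω - R.η • R.stochGrad N k i ω

/-- The squared deviation of the local models from their average, summed over the workers. -/
def consensusError (R : Run d m M b S Ω) (N : MatchaScheme m M) (k : ℕ) (ω : Ω) : ℝ :=
  ∑ i, ‖R.iterate N k i ω - R.avgIterate N k ω‖ ^ 2

theorem iterate_succ (k : ℕ) (i : Fin m) (ω : Ω) : R.iterate N (k + 1) i ω
    = ∑ j, N.mixing (fun l => R.B k l ω) i j • R.halfStep N k j ω := rfl

/-- Mixing preserves the average, since the columns of the mixing matrix sum to one. -/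
theorem avgIterate_succ (k : ℕ) (ω : Ω) :
    R.avgIterate N (k + 1) ω = (1 / (m : ℝ)) • ∑ j, R.halfStep N k j ω := by
  unfold avgIterate
  simp_rw [iterate_succ]
  rw [Finset.sum_comm]
  simp_rw [← Finset.sum_smul, N.sum_mixing_col, one_smul]

variable [MeasurableSpace S] {P : LearningProblem d m S}

/-- The error of the stochastic gradient of worker `i` in iteration `k`. -/
def noise (R : Run d m M b S Ω) (N : MatchaScheme m M) (P : LearningProblem d m S) (k : ℕ)
    (i : Fin m) (ω : Ω) : EuclideanSpace ℝ (Fin d) :=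
  R.stochGrad N k i ω - gradient (P.localObj i) (R.iterate N k i ω)

variable [MeasurableSpace Ω] {μ : Measure Ω}

theorem IsSampled.measurable_avgIterate (h : R.IsSampled N P μ) (k : ℕ) :
    Measurable[R.history k] (R.avgIterate N k) :=
  (Finset.measurable_fun_sum _ fun i _ => h.measurable_iterate k i).const_smul (1 / (m : ℝ))

variable {L : ℝ≥0} {σ : ℝ} {K : ℕ}

theorem IsSampled.measurable_gradient_iterate (h : R.IsSampled N P μ) (hL : P.Smooth L) (k : ℕ)
    (i : Fin m) :
    Measurable[R.history k] (fun ω => gradient (P.localObj i) (R.iterate N k i ω)) :=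
  (hL i).2.continuous.measurable.comp (h.measurable_iterate k i)

theorem IsSampled.measurable_gradient_avgIterate (h : R.IsSampled N P μ) (hL : P.Smooth L)
    (k : ℕ) : Measurable[R.history k] (fun ω => gradient P.obj (R.avgIterate N k ω)) :=
  hL.lipschitzWith_gradient_obj.continuous.measurable.comp (h.measurable_avgIterate k)

theorem IsSampled.measurable_noise (h : R.IsSampled N P μ) (hL : P.Smooth L) (k : ℕ)
    (i : Fin m) : Measurable[R.history k ⊔ R.source (k, Sum.inl i)] (R.noise N P k i) :=
  (h.measurable_stochGrad k i).sub ((h.measurable_gradient_iterate hL k i).mono le_sup_left le_rfl)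

theorem IsSampled.memLp_noise (h : R.IsSampled N P μ) (hL : P.Smooth L)
    (hv : R.BoundedVariance N P μ K σ) {k : ℕ} (hk : k < K) (i : Fin m) :
    MemLp (R.noise N P k i) 2 μ := by
  have hm := (h.measurable_noise hL k i).mono (sup_le (h.history_le k) (h.source_le _)) le_rfl
  exact (memLp_two_iff_integrable_sq_norm hm.aestronglyMeasurable).2 (hv k hk i).1

variable [IsProbabilityMeasure μ]

theorem BoundedVariance.integral_norm_noise_sq_le (hv : R.BoundedVariance N P μ K σ)
    (h : R.IsSampled N P μ) {k : ℕ} (hk : k < K) (i : Fin m) :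
    ∫ ω, ‖R.noise N P k i ω‖ ^ 2 ∂μ ≤ σ ^ 2 := by
  rw [← integral_condExp (h.history_le k)]
  refine (integral_mono_ae integrable_condExp (integrable_const (σ ^ 2)) (hv k hk i).2).trans ?_
  simp

theorem IsSampled.memLp_iterate (h : R.IsSampled N P μ) (hL : P.Smooth L)
    (hv : R.BoundedVariance N P μ K σ) {k : ℕ} (hk : k ≤ K) (i : Fin m) :
    MemLp (R.iterate N k i) 2 μ := by
  induction k generalizing i with
  | zero => exact memLp_const _
  | succ k ih =>
    change MemLp (fun ω => ∑ j, N.mixing (fun l => R.B k l ω) i j • R.halfStep N k j ω) 2 μ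
    refine memLp_finsetSum _ fun j _ => ?_
    have hx := ih (by omega) j
    have hg : MemLp (R.stochGrad N k j) 2 μ := by
      convert (h.memLp_noise hL hv hk j).add ((hL j).2.comp_memLp_of_isFiniteMeasure hx) using 1
      funext ω
      simp [noise]
    have hy : MemLp (R.halfStep N k j) 2 μ := hx.sub (hg.const_smul R.η)
    -- the mixing matrix takes finitely many values
    obtain ⟨C, hC⟩ := (Set.finite_range fun c : Fin M → Bool => ‖N.mixing c i j‖).bddAbove
    have hW : Measurable (fun ω => N.mixing (fun l => R.B k l ω) i j) :=
      (measurable_of_countable fun c : Fin M → Bool => N.mixing c i j).comp (h.measurable_B_pi k)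
    refine MemLp.of_le_mul (c := C) hy (hW.aestronglyMeasurable.smul hy.1)
      (.of_forall fun ω => ?_)
    rw [norm_smul]
    gcongr
    exact hC ⟨_, rfl⟩

theorem IsSampled.memLp_avgIterate (h : R.IsSampled N P μ) (hL : P.Smooth L)
    (hv : R.BoundedVariance N P μ K σ) {k : ℕ} (hk : k ≤ K) :
    MemLp (R.avgIterate N k) 2 μ :=
  (memLp_finsetSum _ fun i _ => h.memLp_iterate hL hv hk i).const_smul (1 / (m : ℝ))

theorem IsSampled.memLp_gradient_iterate (h : R.IsSampled N P μ) (hL : P.Smooth L)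
    (hv : R.BoundedVariance N P μ K σ) {k : ℕ} (hk : k ≤ K) (i : Fin m) :
    MemLp (fun ω => gradient (P.localObj i) (R.iterate N k i ω)) 2 μ :=
  (hL i).2.comp_memLp_of_isFiniteMeasure (h.memLp_iterate hL hv hk i)

theorem IsSampled.memLp_gradient_avgIterate (h : R.IsSampled N P μ) (hL : P.Smooth L)
    (hv : R.BoundedVariance N P μ K σ) {k : ℕ} (hk : k ≤ K) :
    MemLp (fun ω => gradient P.obj (R.avgIterate N k ω)) 2 μ :=
  hL.lipschitzWith_gradient_obj.comp_memLp_of_isFiniteMeasure (h.memLp_avgIterate hL hv hk)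

theorem IsSampled.integrable_consensusError (h : R.IsSampled N P μ) (hL : P.Smooth L)
    (hv : R.BoundedVariance N P μ K σ) {k : ℕ} (hk : k ≤ K) :
    Integrable (R.consensusError N k) μ :=
  integrable_finsetSum _ fun i _ =>
    ((h.memLp_iterate hL hv hk i).sub (h.memLp_avgIterate hL hv hk)).integrable_norm_pow
      two_ne_zero

theorem IsSampled.condExp_noise (h : R.IsSampled N P μ) (hL : P.Smooth L)
    (hu : R.Unbiased N P μ K) (hv : R.BoundedVariance N P μ K σ) {k : ℕ} (hk : k < K)
    (i : Fin m) : μ[R.noise N P k i | R.history k] =ᵐ[μ] 0 := by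
  have hg : Integrable (fun ω => gradient (P.localObj i) (R.iterate N k i ω)) μ :=
    (h.memLp_gradient_iterate hL hv hk.le i).integrable (by norm_num)
  have h1 := condExp_sub (hu k hk i).1 hg (R.history k)
  have h2 := condExp_of_stronglyMeasurable (h.history_le k)
    (h.measurable_gradient_iterate hL k i).stronglyMeasurable hg
  rw [h2] at h1
  refine h1.trans ?_
  filter_upwards [(hu k hk i).2] with ω hω
  simp [hω]

/-- The errors of different workers are uncorrelated: an independent mini-batch of another worker
leaves the error unbiased. -/
theorem IsSampled.integral_inner_noise_eq_zero (h : R.IsSampled N P μ) (hL : P.Smooth L)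
    (hu : R.Unbiased N P μ K) (hv : R.BoundedVariance N P μ K σ) {k : ℕ} (hk : k < K)
    {i j : Fin m} (hij : i ≠ j) :
    ∫ ω, inner ℝ (R.noise N P k i ω) (R.noise N P k j ω) ∂μ = 0 := by
  have hj := h.memLp_noise hL hv hk j
  refine integral_inner_eq_zero_of_condExp_eq_zero
    (sup_le (h.history_le k) (h.source_le (k, Sum.inl i)))
    (h.measurable_noise hL k i).stronglyMeasurable (h.memLp_noise hL hv hk i) hj ?_
  exact condExp_sup_ae_eq_zero le_sup_left (sup_le (h.history_le k) (h.source_le _))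
    (h.source_le _) (h.indep_stochGrad k hij) (hj.integrable (by norm_num))
    (h.measurable_noise hL k j).stronglyMeasurable (h.condExp_noise hL hu hv hk j)

/-- Averaging over the workers divides the variance of the gradient noise by their number. -/
theorem IsSampled.integral_norm_average_noise_sq_le (h : R.IsSampled N P μ) (hL : P.Smooth L)
    (hu : R.Unbiased N P μ K) (hv : R.BoundedVariance N P μ K σ) {k : ℕ} (hk : k < K) :
    ∫ ω, ‖(1 / (m : ℝ)) • ∑ i, R.noise N P k i ω‖ ^ 2 ∂μ ≤ σ ^ 2 / m := by
  have hm : (0 : ℝ) < m := by exact_mod_cast N.pos_workers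
  have hint : ∀ i j, Integrable (fun ω => inner ℝ (R.noise N P k i ω) (R.noise N P k j ω)) μ :=
    fun i j => integrable_inner_of_memLp_two (h.memLp_noise hL hv hk i) (h.memLp_noise hL hv hk j)
  have h1 : ∀ ω, ‖(1 / (m : ℝ)) • ∑ i, R.noise N P k i ω‖ ^ 2 = (1 / (m : ℝ)) ^ 2 *
      ∑ i, ∑ j, inner ℝ (R.noise N P k i ω) (R.noise N P k j ω) := fun ω => by
    rw [norm_smul, mul_pow, Real.norm_of_nonneg (by positivity), ← real_inner_self_eq_norm_sq,
      sum_inner]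
    simp_rw [inner_sum]
  simp_rw [h1]
  rw [integral_const_mul, integral_finsetSum _ fun i _ => integrable_finsetSum _ fun j _ =>
    hint i j]
  have h2 : ∀ i, ∫ ω, ∑ j, inner ℝ (R.noise N P k i ω) (R.noise N P k j ω) ∂μ ≤ σ ^ 2 := by
    intro i
    rw [integral_finsetSum _ fun j _ => hint i j, Finset.sum_eq_single i
      (fun j _ hj => h.integral_inner_noise_eq_zero hL hu hv hk hj.symm) (by simp)]
    simp_rw [real_inner_self_eq_norm_sq]
    exact hv.integral_norm_noise_sq_le h hk i
  calc _ ≤ (1 / (m : ℝ)) ^ 2 * ∑ _i : Fin m, σ ^ 2 := by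
        gcongr with i
        exact h2 i
    _ = σ ^ 2 / m := by
        simp
        field_simp

/-! ### The consensus error -/

theorem IsSampled.integrable_comp_B (h : R.IsSampled N P μ) (k : ℕ) (φ : (Fin M → Bool) → ℝ) :
    Integrable (fun ω => φ fun l => R.B k l ω) μ := by
  have := Measure.isProbabilityMeasure_map (μ := μ) (h.measurable_B_pi k).aemeasurable
  exact Integrable.comp_measurable (Integrable.of_finite (f := φ)) (h.measurable_B_pi k)

theorem IsSampled.memLp_halfStep_sub (h : R.IsSampled N P μ) (hL : P.Smooth L)
    (hv : R.BoundedVariance N P μ K σ) {k : ℕ} (hk : k < K) (j : Fin m)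
    {c : Ω → EuclideanSpace ℝ (Fin d)} (hc : MemLp c 2 μ) :
    MemLp (fun ω => R.halfStep N k j ω - c ω) 2 μ := by
  have hg : MemLp (R.stochGrad N k j) 2 μ := by
    convert (h.memLp_noise hL hv hk j).add (h.memLp_gradient_iterate hL hv hk.le j) using 1
    funext ω
    simp [noise]
  exact ((h.memLp_iterate hL hv hk.le j).sub (hg.const_smul R.η)).sub hc

/-- Mixing contracts the deviation from any reference point known before the mixing, since the
activated matchings are independent of the half steps. -/
theorem IsSampled.integral_consensusError_succ_le (h : R.IsSampled N P μ) (hL : P.Smooth L)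
    (hv : R.BoundedVariance N P μ K σ) {k : ℕ} (hk : k < K)
    {c : Ω → EuclideanSpace ℝ (Fin d)} (hcm : Measurable[R.history k] c) (hc : MemLp c 2 μ) :
    ∫ ω, R.consensusError N (k + 1) ω ∂μ
      ≤ N.spectralNorm μ (R.B 0) * ∫ ω, ∑ j, ‖R.halfStep N k j ω - c ω‖ ^ 2 ∂μ := by
  let φ : Fin m → Fin m → (Fin M → Bool) → ℝ := fun j l c =>
    ((N.mixing c).transpose * N.mixing c) j l - 1 / (m : ℝ)
  let z : Fin m → Ω → EuclideanSpace ℝ (Fin d) := fun j ω => R.halfStep N k j ω - c ω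
  have hz : ∀ j, MemLp (z j) 2 μ := fun j => h.memLp_halfStep_sub hL hv hk j hc
  have hzm : ∀ j, Measurable[R.preMixing k] (z j) := fun j => by
    have h1 : Measurable[R.preMixing k] (R.stochGrad N k j) := (h.measurable_stochGrad k j).mono
      (sup_le (history_le_preMixing k) (source_le_preMixing k j)) le_rfl
    have h2 := (h.measurable_iterate k j).mono (history_le_preMixing k) le_rfl
    exact (h2.sub (h1.const_smul R.η)).sub (hcm.mono (history_le_preMixing k) le_rfl)
  have hin : ∀ j l, Integrable (fun ω => inner ℝ (z j ω) (z l ω)) μ := fun j l =>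
    integrable_inner_of_memLp_two (hz j) (hz l)
  have him : ∀ j l, Measurable[R.preMixing k] (fun ω => inner ℝ (z j ω) (z l ω)) := fun j l =>
    (hzm j).inner (hzm l)
  have hprod : ∀ j l, Integrable (fun ω => φ j l (fun q => R.B k q ω) *
      inner ℝ (z j ω) (z l ω)) μ := fun j l =>
    (h.indepFun_comp_B k (φ j l) (him j l)).integrable_mul (h.integrable_comp_B k _) (hin j l)
  have h1 : ∀ ω, R.consensusError N (k + 1) ω = ∑ j, ∑ l, φ j l (fun q => R.B k q ω) *
      inner ℝ (z j ω) (z l ω) := fun ω => by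
    unfold consensusError
    simp_rw [avgIterate_succ, iterate_succ]
    exact sum_norm_sq_sum_smul_sub_average N.pos_workers (N.sum_mixing_row _) (N.sum_mixing_col _) _ _
  let A : Matrix (Fin m) (Fin m) ℝ := Matrix.of fun a c =>
    (∫ ω, ((N.mixing (fun j => R.B 0 j ω)).transpose * N.mixing (fun j => R.B 0 j ω)) a c ∂μ)
      - 1 / (m : ℝ)
  have h2 : ∀ j l, ∫ ω, φ j l (fun q => R.B 0 q ω) ∂μ = A j l := fun j l => by
    simp only [φ]
    rw [integral_sub (h.integrable_comp_B 0 fun c => ((N.mixing c).transpose * N.mixing c) j l)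
      (integrable_const _)]
    simp [A]
  simp_rw [h1]
  rw [integral_finsetSum _ fun j _ => integrable_finsetSum _ fun l _ => hprod j l]
  simp_rw [integral_finsetSum _ fun l _ => hprod _ l, h.integral_comp_B_mul k _ (him _ _), h2]
  rw [← integral_const_mul]
  have hA : ∀ j, Integrable (fun ω => ∑ l, A j l * inner ℝ (z j ω) (z l ω)) μ := fun j =>
    integrable_finsetSum _ fun l _ => (hin j l).const_mul _
  calc _ = ∫ ω, ∑ j, ∑ l, A j l * inner ℝ (z j ω) (z l ω) ∂μ := by
        rw [integral_finsetSum _ fun j _ => hA j]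
        refine Finset.sum_congr rfl fun j _ => ?_
        rw [integral_finsetSum _ fun l _ => (hin j l).const_mul _]
        exact Finset.sum_congr rfl fun l _ => (integral_const_mul _ _).symm
    _ ≤ _ := integral_mono (integrable_finsetSum _ fun j _ => hA j)
        ((integrable_finsetSum _ fun j _ => (hz j).integrable_norm_pow two_ne_zero).const_mul _)
        fun ω => sum_sum_mul_inner_le A fun j => z j ω

/-- A deterministic bound for one noiseless gradient step, relative to the step of the average
along the global gradient. The convexity weight `r` dominates the contraction factor. -/
theorem mul_sum_norm_gradient_step_sq_le (hL : P.Smooth L) {ζ η ρ r : ℝ}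
    (hζ : P.BoundedDeviation ζ) (hm : 0 < m) (hη : 0 ≤ η) (hρ : 0 ≤ ρ)
    (hr : √ρ * (1 + η * L) ≤ r) (hr1 : r < 1) (x : Fin m → EuclideanSpace ℝ (Fin d))
    (a : EuclideanSpace ℝ (Fin d)) :
    ρ * ∑ i, ‖x i - η • gradient (P.localObj i) (x i) - (a - η • gradient P.obj a)‖ ^ 2
      ≤ r * ∑ i, ‖x i - a‖ ^ 2 + ρ * (η ^ 2 * (m * ζ ^ 2)) / (1 - r) := by
  have hm' : (0 : ℝ) < m := by exact_mod_cast hm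
  have hζ' : ∑ i, ‖gradient (P.localObj i) a - gradient P.obj a‖ ^ 2 ≤ m * ζ ^ 2 := by
    have := hζ a
    rw [one_div, inv_mul_le_iff₀ hm'] at this
    exact this
  have hr0 : 0 ≤ r := le_trans (by positivity) hr
  have h1r : 0 < 1 - r := by linarith
  have key : ∀ i, ρ * ‖x i - η • gradient (P.localObj i) (x i) - (a - η • gradient P.obj a)‖ ^ 2
      ≤ r * ‖x i - a‖ ^ 2
        + ρ * (η ^ 2 * ‖gradient (P.localObj i) a - gradient P.obj a‖ ^ 2) / (1 - r) := by
    intro i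
    set u := ‖x i - a‖ with hu
    set w := ‖gradient (P.localObj i) a - gradient P.obj a‖ with hw
    have h1 : ‖x i - η • gradient (P.localObj i) (x i) - (a - η • gradient P.obj a)‖
        ≤ (1 + η * L) * u + η * w := by
      have e : x i - η • gradient (P.localObj i) (x i) - (a - η • gradient P.obj a)
          = (x i - a) - η • (gradient (P.localObj i) (x i) - gradient (P.localObj i) a)
            - η • (gradient (P.localObj i) a - gradient P.obj a) := by
        module
      rw [e]
      refine (norm_sub_le _ _).trans (add_le_add ((norm_sub_le _ _).trans ?_) ?_)
      · rw [norm_smul, Real.norm_of_nonneg hη, add_mul, one_mul, mul_assoc]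
        gcongr
        exact (hL i).2.norm_sub_le _ _
      · rw [norm_smul, Real.norm_of_nonneg hη]
    have h2 : √ρ * ‖x i - η • gradient (P.localObj i) (x i) - (a - η • gradient P.obj a)‖
        ≤ r * u + √ρ * (η * w) := by
      calc _ ≤ √ρ * ((1 + η * L) * u + η * w) := by gcongr
        _ = √ρ * (1 + η * L) * u + √ρ * (η * w) := by ring
        _ ≤ _ := by gcongr
    have h3 := pow_le_pow_left₀ (by positivity) h2 2
    rw [mul_pow, Real.sq_sqrt hρ] at h3
    refine h3.trans ?_
    -- convexity of the square, with weights `r` and `1 - r`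
    have h4 : r * u ^ 2 + (√ρ * (η * w)) ^ 2 / (1 - r) - (r * u + √ρ * (η * w)) ^ 2
        = r / (1 - r) * ((1 - r) * u - √ρ * (η * w)) ^ 2 := by
      field_simp
      ring
    have h5 : 0 ≤ r / (1 - r) * ((1 - r) * u - √ρ * (η * w)) ^ 2 := by positivity
    have h6 : (√ρ * (η * w)) ^ 2 = ρ * (η ^ 2 * w ^ 2) := by
      rw [mul_pow, Real.sq_sqrt hρ, mul_pow]
    rw [h6] at h4
    linarith
  rw [Finset.mul_sum]
  refine (Finset.sum_le_sum fun i _ => key i).trans ?_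
  rw [Finset.sum_add_distrib, ← Finset.mul_sum, ← Finset.sum_div, ← Finset.mul_sum,
    ← Finset.mul_sum]
  gcongr

/-- The recursion for the consensus error. The reference point is the step of the average along the
global gradient: it is known before the mini-batches are drawn, hence uncorrelated with the noise,
and it cancels the common part of the local gradients. -/
theorem IsSampled.integral_consensusError_succ_le_mul_add (h : R.IsSampled N P μ)
    (hL : P.Smooth L) (hu : R.Unbiased N P μ K) (hv : R.BoundedVariance N P μ K σ) {ζ r : ℝ}
    (hζ : P.BoundedDeviation ζ) (hη : 0 ≤ R.η)
    (hr : √(N.spectralNorm μ (R.B 0)) * (1 + R.η * L) ≤ r) (hr1 : r < 1) {k : ℕ} (hk : k < K) :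
    ∫ ω, R.consensusError N (k + 1) ω ∂μ ≤ r * ∫ ω, R.consensusError N k ω ∂μ
      + N.spectralNorm μ (R.B 0) * (R.η ^ 2 * m * (ζ ^ 2 / (1 - r) + σ ^ 2)) := by
  set ρ := N.spectralNorm μ (R.B 0) with hρdef
  have hρ : 0 ≤ ρ := norm_nonneg _
  let c : Ω → EuclideanSpace ℝ (Fin d) := fun ω =>
    R.avgIterate N k ω - R.η • gradient P.obj (R.avgIterate N k ω)
  let a : Fin m → Ω → EuclideanSpace ℝ (Fin d) := fun j ω =>
    R.iterate N k j ω - R.η • gradient (P.localObj j) (R.iterate N k j ω) - c ω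
  have hcm : Measurable[R.history k] c :=
    (h.measurable_avgIterate k).sub ((h.measurable_gradient_avgIterate hL k).const_smul R.η)
  have hc : MemLp c 2 μ := (h.memLp_avgIterate hL hv hk.le).sub
    ((h.memLp_gradient_avgIterate hL hv hk.le).const_smul R.η)
  have ham : ∀ j, Measurable[R.history k] (a j) := fun j =>
    ((h.measurable_iterate k j).sub ((h.measurable_gradient_iterate hL k j).const_smul R.η)).sub hcm
  have ha : ∀ j, MemLp (a j) 2 μ := fun j => ((h.memLp_iterate hL hv hk.le j).sub
    ((h.memLp_gradient_iterate hL hv hk.le j).const_smul R.η)).sub hc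
  have hn := h.memLp_noise hL hv hk
  have ha2 : ∀ j, Integrable (fun ω => ‖a j ω‖ ^ 2) μ := fun j =>
    (ha j).integrable_norm_pow two_ne_zero
  have hn2 : ∀ j, Integrable (fun ω => ‖R.noise N P k j ω‖ ^ 2) μ := fun j =>
    (hn j).integrable_norm_pow two_ne_zero
  have hsplit : ∀ j, ∫ ω, ‖R.halfStep N k j ω - c ω‖ ^ 2 ∂μ
      ≤ ∫ ω, ‖a j ω‖ ^ 2 ∂μ + R.η ^ 2 * σ ^ 2 := fun j => by
    have e : ∀ ω, ‖R.halfStep N k j ω - c ω‖ ^ 2 = ‖a j ω‖ ^ 2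
        - 2 * R.η * inner ℝ (a j ω) (R.noise N P k j ω) + R.η ^ 2 * ‖R.noise N P k j ω‖ ^ 2 := by
      intro ω
      have e1 : R.halfStep N k j ω - c ω = a j ω - R.η • R.noise N P k j ω := by
        simp only [halfStep, noise, a]
        module
      rw [e1, norm_sub_sq_real, inner_smul_right, norm_smul, mul_pow, Real.norm_of_nonneg hη]
      ring
    simp_rw [e]
    have hin := (integrable_inner_of_memLp_two (ha j) (hn j)).const_mul (2 * R.η)
    have hsub : Integrable (fun ω => ‖a j ω‖ ^ 2
        - 2 * R.η * inner ℝ (a j ω) (R.noise N P k j ω)) μ := (ha2 j).sub hin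
    rw [integral_add hsub ((hn2 j).const_mul _), integral_sub (ha2 j) hin,
      integral_const_mul, integral_const_mul, integral_inner_eq_zero_of_condExp_eq_zero
        (h.history_le k) (ham j).stronglyMeasurable (ha j) (hn j) (h.condExp_noise hL hu hv hk j),
      mul_zero, sub_zero]
    gcongr
    exact hv.integral_norm_noise_sq_le h hk j
  have hdet : ρ * ∑ j, ∫ ω, ‖a j ω‖ ^ 2 ∂μ ≤ r * ∫ ω, R.consensusError N k ω ∂μ
      + ρ * (R.η ^ 2 * (m * ζ ^ 2)) / (1 - r) := by
    rw [← integral_finsetSum _ fun j _ => ha2 j, ← integral_const_mul, ← integral_const_mul]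
    have hce := (h.integrable_consensusError hL hv hk.le).const_mul r
    refine (integral_mono ((integrable_finsetSum _ fun j _ => ha2 j).const_mul ρ)
      (hce.add (integrable_const (ρ * (R.η ^ 2 * (m * ζ ^ 2)) / (1 - r)))) fun ω =>
      mul_sum_norm_gradient_step_sq_le hL hζ N.pos_workers hη hρ hr hr1 _ _).trans ?_
    rw [integral_add' hce (integrable_const _)]
    simp
  calc _ ≤ ρ * ∫ ω, ∑ j, ‖R.halfStep N k j ω - c ω‖ ^ 2 ∂μ :=
        h.integral_consensusError_succ_le hL hv hk hcm hc
    _ = ρ * ∑ j, ∫ ω, ‖R.halfStep N k j ω - c ω‖ ^ 2 ∂μ := by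
        rw [integral_finsetSum _ fun j _ =>
          (h.memLp_halfStep_sub hL hv hk j hc).integrable_norm_pow two_ne_zero]
    _ ≤ ρ * ∑ j, (∫ ω, ‖a j ω‖ ^ 2 ∂μ + R.η ^ 2 * σ ^ 2) := by
        gcongr with j
        exact hsplit j
    _ = ρ * ∑ j, ∫ ω, ‖a j ω‖ ^ 2 ∂μ + ρ * (m * (R.η ^ 2 * σ ^ 2)) := by
        rw [Finset.sum_add_distrib, mul_add]
        simp
    _ ≤ _ := by
        have e : ρ * (R.η ^ 2 * m * (ζ ^ 2 / (1 - r) + σ ^ 2))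
            = ρ * (R.η ^ 2 * (m * ζ ^ 2)) / (1 - r) + ρ * (m * (R.η ^ 2 * σ ^ 2)) := by ring
        rw [e]
        linarith

/-- The bound is the fixed point of the recursion, with `ρ` replaced by one in the additive term. -/
theorem IsSampled.integral_consensusError_le (h : R.IsSampled N P μ)
    (hL : P.Smooth L) (hu : R.Unbiased N P μ K) (hv : R.BoundedVariance N P μ K σ) {ζ r : ℝ}
    (hζ : P.BoundedDeviation ζ) (hη : 0 ≤ R.η) (hρ1 : N.spectralNorm μ (R.B 0) ≤ 1)
    (hr : √(N.spectralNorm μ (R.B 0)) * (1 + R.η * L) ≤ r) (hr1 : r < 1) {k : ℕ} (hk : k ≤ K) :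
    ∫ ω, R.consensusError N k ω ∂μ
      ≤ R.η ^ 2 * m * ((ζ ^ 2 / (1 - r) + σ ^ 2) / (1 - r)) := by
  have h1r : 0 < 1 - r := by linarith
  have hr0 : 0 ≤ r := le_trans (by positivity) hr
  induction k with
  | zero =>
    have hm : (m : ℝ) ≠ 0 := by exact_mod_cast N.pos_workers.ne'
    have : ∀ ω, R.consensusError N 0 ω = 0 := fun ω => by
      simp [consensusError, avgIterate, iterate, ← Nat.cast_smul_eq_nsmul ℝ, smul_smul, hm]
    simp_rw [this]
    simp only [integral_zero]
    positivity
  | succ k ih =>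
    refine (h.integral_consensusError_succ_le_mul_add hL hu hv hζ hη hr hr1 hk).trans ?_
    have h1 := mul_le_mul_of_nonneg_left (ih (by omega)) hr0
    have h2 : N.spectralNorm μ (R.B 0) * (R.η ^ 2 * m * (ζ ^ 2 / (1 - r) + σ ^ 2))
        ≤ R.η ^ 2 * m * (ζ ^ 2 / (1 - r) + σ ^ 2) :=
      mul_le_of_le_one_left (by positivity) hρ1
    have h3 : R.η ^ 2 * m * ((ζ ^ 2 / (1 - r) + σ ^ 2) / (1 - r))
        = r * (R.η ^ 2 * m * ((ζ ^ 2 / (1 - r) + σ ^ 2) / (1 - r)))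
          + R.η ^ 2 * m * (ζ ^ 2 / (1 - r) + σ ^ 2) := by
      field_simp
      ring
    linarith

end Run

/-! ### Descent of the objective along the averaged iterate -/

namespace Run

variable {d m M b : ℕ} {S Ω : Type*} {R : Run d m M b S Ω} {N : MatchaScheme m M}
  [MeasurableSpace S] {P : LearningProblem d m S}

/-- The average of the local gradients at the local models. -/
def avgGradient (R : Run d m M b S Ω) (N : MatchaScheme m M) (P : LearningProblem d m S) (k : ℕ)
    (ω : Ω) : EuclideanSpace ℝ (Fin d) :=
  (1 / (m : ℝ)) • ∑ i, gradient (P.localObj i) (R.iterate N k i ω)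

/-- The average over the workers of the errors of the stochastic gradients. -/
def avgNoise (R : Run d m M b S Ω) (N : MatchaScheme m M) (P : LearningProblem d m S) (k : ℕ)
    (ω : Ω) : EuclideanSpace ℝ (Fin d) :=
  (1 / (m : ℝ)) • ∑ i, R.noise N P k i ω

theorem avgIterate_succ_eq (k : ℕ) (ω : Ω) : R.avgIterate N (k + 1) ω
    = R.avgIterate N k ω + -(R.η • (R.avgGradient N P k ω + R.avgNoise N P k ω)) := by
  rw [avgIterate_succ, avgIterate, avgGradient, avgNoise, ← smul_add, ← Finset.sum_add_distrib,
    smul_comm, ← smul_neg, ← smul_add, Finset.smul_sum (r := R.η), ← Finset.sum_neg_distrib,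
    ← Finset.sum_add_distrib]
  congr 1
  refine Finset.sum_congr rfl fun i _ => ?_
  simp only [halfStep, noise]
  module

/-- The part of the direction of the step that is known before the mini-batches are drawn, paired
with the noise in the descent inequality. -/
def crossDirection (R : Run d m M b S Ω) (N : MatchaScheme m M) (P : LearningProblem d m S)
    (L : ℝ≥0) (k : ℕ) (ω : Ω) : EuclideanSpace ℝ (Fin d) :=
  (L * R.η ^ 2) • R.avgGradient N P k ω - R.η • gradient P.obj (R.avgIterate N k ω)

/-- The descent inequality for one step of the average. The term in `‖avgGradient‖ ^ 2` has
coefficient `-(η / 2) (1 - η L)` and is dropped. -/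
theorem norm_gradient_sq_add_obj_succ_le {L : ℝ≥0} (hL : P.Smooth L) (hη : 0 ≤ R.η)
    (hηL : R.η * L ≤ 1) (k : ℕ) (ω : Ω) :
    R.η / 2 * ‖gradient P.obj (R.avgIterate N k ω)‖ ^ 2 + P.obj (R.avgIterate N (k + 1) ω)
      ≤ P.obj (R.avgIterate N k ω) + R.η / 2 * (L ^ 2 * (1 / m)) * R.consensusError N k ω
        + L * R.η ^ 2 / 2 * ‖R.avgNoise N P k ω‖ ^ 2
        + inner ℝ (R.crossDirection N P L k ω) (R.avgNoise N P k ω) := by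
  have h1 := le_add_inner_add_of_lipschitzWith_gradient hL.differentiable_obj
    hL.lipschitzWith_gradient_obj (R.avgIterate N k ω)
    (-(R.η • (R.avgGradient N P k ω + R.avgNoise N P k ω)))
  rw [← avgIterate_succ_eq] at h1
  have h2 := hL.norm_average_gradient_sub_sq_le (R.avgIterate N k ω)
    fun i => R.iterate N k i ω
  change ‖gradient P.obj (R.avgIterate N k ω) - R.avgGradient N P k ω‖ ^ 2
    ≤ L ^ 2 * (1 / m * R.consensusError N k ω) at h2
  rw [norm_sub_sq_real] at h2
  rw [norm_neg, norm_smul, mul_pow, norm_add_sq_real, inner_neg_right, inner_smul_right,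
    inner_add_right, Real.norm_of_nonneg hη] at h1
  rw [crossDirection, inner_sub_left, inner_smul_left, inner_smul_left]
  simp only [conj_trivial]
  have h3 := mul_le_mul_of_nonneg_left h2 (by positivity : 0 ≤ R.η / 2)
  have h4 : 0 ≤ R.η / 2 * (1 - R.η * L) * ‖R.avgGradient N P k ω‖ ^ 2 := by
    have : 0 ≤ 1 - R.η * L := by linarith
    positivity
  linarith

variable [MeasurableSpace Ω] {μ : Measure Ω} [IsProbabilityMeasure μ] {L : ℝ≥0} {σ : ℝ} {K : ℕ}

theorem IsSampled.integral_inner_crossDirection_avgNoise (h : R.IsSampled N P μ)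
    (hL : P.Smooth L) (hu : R.Unbiased N P μ K) (hv : R.BoundedVariance N P μ K σ) {k : ℕ}
    (hk : k < K) :
    Integrable (fun ω => inner ℝ (R.crossDirection N P L k ω) (R.avgNoise N P k ω)) μ ∧
      ∫ ω, inner ℝ (R.crossDirection N P L k ω) (R.avgNoise N P k ω) ∂μ = 0 := by
  have hgm : Measurable[R.history k] (R.avgGradient N P k) :=
    (Finset.measurable_fun_sum _ fun i _ => h.measurable_gradient_iterate hL k i).const_smul
      (1 / (m : ℝ))
  have hg : MemLp (R.avgGradient N P k) 2 μ :=
    (memLp_finsetSum _ fun i _ => h.memLp_gradient_iterate hL hv hk.le i).const_smul (1 / (m : ℝ))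
  have ham : Measurable[R.history k] (R.crossDirection N P L k) :=
    (hgm.const_smul (L * R.η ^ 2 : ℝ)).sub
      ((h.measurable_gradient_avgIterate hL k).const_smul R.η)
  have ha : MemLp (R.crossDirection N P L k) 2 μ :=
    (hg.const_smul (L * R.η ^ 2 : ℝ)).sub
      ((h.memLp_gradient_avgIterate hL hv hk.le).const_smul R.η)
  have hn := fun i => h.memLp_noise hL hv hk i
  have hin := fun i => integrable_inner_of_memLp_two ha (hn i)
  simp only [avgNoise, inner_smul_right, inner_sum]
  refine ⟨(integrable_finsetSum _ fun i _ => hin i).const_mul _, ?_⟩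
  rw [integral_const_mul, integral_finsetSum _ fun i _ => hin i,
    Finset.sum_eq_zero fun i _ => ?_, mul_zero]
  exact integral_inner_eq_zero_of_condExp_eq_zero (h.history_le k) ham.stronglyMeasurable ha
    (hn i) (h.condExp_noise hL hu hv hk i)

theorem IsSampled.integral_descent (h : R.IsSampled N P μ)
    (hL : P.Smooth L) (hu : R.Unbiased N P μ K) (hv : R.BoundedVariance N P μ K σ)
    (hη : 0 ≤ R.η) (hηL : R.η * L ≤ 1) {Finf : ℝ} (hF : ∀ x, Finf ≤ P.obj x) {k : ℕ}
    (hk : k < K) :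
    R.η / 2 * ∫ ω, ‖gradient P.obj (R.avgIterate N k ω)‖ ^ 2 ∂μ
      ≤ ∫ ω, P.obj (R.avgIterate N k ω) ∂μ - ∫ ω, P.obj (R.avgIterate N (k + 1) ω) ∂μ
        + R.η / 2 * (L ^ 2 * (1 / m)) * ∫ ω, R.consensusError N k ω ∂μ
        + L * R.η ^ 2 / 2 * (σ ^ 2 / m) := by
  have hobj : ∀ k ≤ K, Integrable (fun ω => P.obj (R.avgIterate N k ω)) μ := fun k hk =>
    integrable_comp_of_lipschitzWith_gradient hL.differentiable_obj hL.lipschitzWith_gradient_obj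
      hF (h.memLp_avgIterate hL hv hk)
  have hg : Integrable (fun ω => R.η / 2 * ‖gradient P.obj (R.avgIterate N k ω)‖ ^ 2) μ :=
    ((h.memLp_gradient_avgIterate hL hv hk.le).integrable_norm_pow two_ne_zero).const_mul _
  have hc : Integrable (fun ω => R.η / 2 * (L ^ 2 * (1 / m)) * R.consensusError N k ω) μ :=
    (h.integrable_consensusError hL hv hk.le).const_mul _
  have hn : Integrable (fun ω => L * R.η ^ 2 / 2 * ‖R.avgNoise N P k ω‖ ^ 2) μ :=
    (((memLp_finsetSum _ fun i _ => h.memLp_noise hL hv hk i).const_smul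
      (1 / (m : ℝ))).integrable_norm_pow two_ne_zero).const_mul _
  obtain ⟨hx, hx0⟩ := h.integral_inner_crossDirection_avgNoise hL hu hv hk
  have h1 := (hobj k hk.le).add hc
  have h2 := h1.add hn
  have key := integral_mono (hg.add (hobj (k + 1) hk)) (h2.add hx)
    fun ω => norm_gradient_sq_add_obj_succ_le hL hη hηL k ω
  rw [integral_add' hg (hobj (k + 1) hk), integral_add' h2 hx, integral_add' h1 hn,
    integral_add' (hobj k hk.le) hc, hx0, integral_const_mul, integral_const_mul,
    integral_const_mul] at key
  have h3 : L * R.η ^ 2 / 2 * ∫ ω, ‖R.avgNoise N P k ω‖ ^ 2 ∂μ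
      ≤ L * R.η ^ 2 / 2 * (σ ^ 2 / m) := by
    gcongr
    exact h.integral_norm_average_noise_sq_le hL hu hv hk
  linarith

/-- Summing the descent inequality over the iterations, with a uniform bound on the consensus
error. -/
theorem IsSampled.average_norm_gradient_sq_le (h : R.IsSampled N P μ)
    (hL : P.Smooth L) (hu : R.Unbiased N P μ K) (hv : R.BoundedVariance N P μ K σ)
    (hη : 0 < R.η) (hηL : R.η * L ≤ 1) {Finf Δ C : ℝ} (hF : ∀ x, Finf ≤ P.obj x)
    (hΔ : P.obj R.x₁ - Finf ≤ Δ) (hK : 0 < K)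
    (hC : ∀ k < K, ∫ ω, R.consensusError N k ω ∂μ ≤ R.η ^ 2 * m * C) :
    (1 / (K : ℝ)) * ∑ k ∈ Finset.range K,
        ∫ ω, ‖gradient P.obj (R.avgIterate N k ω)‖ ^ 2 ∂μ
      ≤ 2 * Δ / (R.η * K) + L * σ ^ 2 * (R.η / m) + L ^ 2 * C * R.η ^ 2 := by
  have hm : (0 : ℝ) < m := by exact_mod_cast N.pos_workers
  have hK' : (0 : ℝ) < K := by exact_mod_cast hK
  set a : ℕ → ℝ := fun k => ∫ ω, P.obj (R.avgIterate N k ω) ∂μ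
  set e : ℝ := R.η / 2 * (L ^ 2 * (1 / m)) * (R.η ^ 2 * m * C) + L * R.η ^ 2 / 2 * (σ ^ 2 / m)
    with he
  -- `a k - a (k + 1)` telescopes
  have hstep : ∀ k ∈ Finset.range K,
      R.η / 2 * ∫ ω, ‖gradient P.obj (R.avgIterate N k ω)‖ ^ 2 ∂μ ≤ a k - a (k + 1) + e := by
    intro k hk
    have h1 := h.integral_descent hL hu hv hη.le hηL hF (Finset.mem_range.1 hk)
    have h2 := mul_le_mul_of_nonneg_left (hC k (Finset.mem_range.1 hk))
      (by positivity : 0 ≤ R.η / 2 * (L ^ 2 * (1 / (m : ℝ))))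
    linarith
  have hsum := Finset.sum_le_sum hstep
  rw [← Finset.mul_sum, Finset.sum_add_distrib, Finset.sum_range_sub', Finset.sum_const,
    Finset.card_range, nsmul_eq_mul] at hsum
  have ha0 : a 0 = P.obj R.x₁ := by
    have : ∀ ω, R.avgIterate N 0 ω = R.x₁ := fun ω => by
      simp [avgIterate, iterate, ← Nat.cast_smul_eq_nsmul ℝ, smul_smul, hm.ne']
    simp [a, this]
  have haK : Finf ≤ a K := by
    have := integral_mono (μ := μ) (integrable_const Finf)
      (integrable_comp_of_lipschitzWith_gradient hL.differentiable_obj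
        hL.lipschitzWith_gradient_obj hF (h.memLp_avgIterate hL hv le_rfl)) fun ω => hF _
    simpa using this
  have hfin : R.η / 2 * ∑ k ∈ Finset.range K, ∫ ω, ‖gradient P.obj (R.avgIterate N k ω)‖ ^ 2 ∂μ
      ≤ Δ + K * e := by linarith
  calc _ = 2 / (R.η * K) * (R.η / 2 * ∑ k ∈ Finset.range K,
          ∫ ω, ‖gradient P.obj (R.avgIterate N k ω)‖ ^ 2 ∂μ) := by field_simp
    _ ≤ 2 / (R.η * K) * (Δ + K * e) := by gcongr
    _ = _ := by
        rw [he]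
        field_simp
        ring

end Run

/-! ### The linear speedup -/

/-- The learning rate condition keeps `√ρ (1 + η L)` away from one by a margin that depends on `ρ`
only. -/
theorem LearningRateCondition.sqrt_mul_le {η L ρ : ℝ} (h : LearningRateCondition η L ρ)
    (hρ : 0 ≤ ρ) : √ρ * (1 + η * L) ≤ (1 + 3 * √ρ) / 4 := by
  rcases hρ.eq_or_lt with rfl | hρ
  · norm_num
  have h1 := mul_le_mul_of_nonneg_left (h.2 hρ) (Real.sqrt_nonneg ρ)
  have h2 : √ρ * √(ρ⁻¹) = 1 := by
    rw [Real.sqrt_inv, mul_inv_cancel₀ (Real.sqrt_pos.2 hρ).ne']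
  linarith

/-- For `ρ ≥ 1` the admissible learning rates force `L = 0`. -/
theorem LearningRateCondition.eq_zero {η ρ : ℝ} {L : ℝ≥0} (h : LearningRateCondition η L ρ)
    (hη : 0 < η) (hρ : 1 ≤ ρ) : L = 0 := by
  have h1 := h.2 (by linarith)
  have h2 : √(ρ⁻¹) ≤ 1 := Real.sqrt_le_one.2 (inv_le_one_of_one_le₀ hρ)
  have h3 : η * L ≤ 0 := by linarith
  have h4 : (L : ℝ) ≤ 0 := nonpos_of_mul_nonpos_right h3 hη
  exact le_antisymm (by exact_mod_cast h4) zero_le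

end

theorem corollary1 (L : ℝ≥0) (σ ζ ρ Δ : ℝ) :
    ∃ C₁ C₂ : ℝ, 0 ≤ C₁ ∧ 0 ≤ C₂ ∧
      ∀ (m M d b K : ℕ) (S Ω : Type*) [MeasurableSpace S] [MeasurableSpace Ω]
        (μ : Measure Ω) [IsProbabilityMeasure μ]
        (N : MatchaScheme m M) (P : LearningProblem d m S) (R : Run d m M b S Ω) (Finf : ℝ),
        1 ≤ K →
        R.IsSampled N P μ →
        P.Smooth L →
        R.Unbiased N P μ K →
        R.BoundedVariance N P μ K σ →
        P.BoundedDeviation ζ →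
        (∀ x, Finf ≤ P.obj x) →
        P.obj R.x₁ - Finf ≤ Δ →
        N.spectralNorm μ (R.B 0) = ρ →
        R.η = √((m : ℝ) / (K : ℝ)) →
        LearningRateCondition R.η L ρ →
        (∀ k < K, Integrable (fun ω => ‖gradient P.obj (R.avgIterate N k ω)‖ ^ 2) μ) ∧
        (1 / (K : ℝ)) * ∑ k ∈ Finset.range K,
            ∫ ω, ‖gradient P.obj (R.avgIterate N k ω)‖ ^ 2 ∂μ
          ≤ C₁ * (1 / √((m : ℝ) * (K : ℝ))) + C₂ * ((m : ℝ) / (K : ℝ)) := by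
  -- `r` bounds the contraction factor of the consensus error for `ρ < 1`; the maximum only makes
  -- the constant nonnegative for the remaining `ρ`, where it plays no role
  set r : ℝ := (1 + 3 * √ρ) / 4 with hr
  set C : ℝ := (ζ ^ 2 / (1 - r) + σ ^ 2) / (1 - r)
  refine ⟨2 * max Δ 0 + L * σ ^ 2, L ^ 2 * max C 0, by positivity, by positivity, ?_⟩
  intro m M d b K S Ω _ _ μ _ N P R Finf hK h hL hu hv hζ hF hΔ hρ hη hrate
  have hm : (0 : ℝ) < m := by exact_mod_cast N.pos_workers
  have hK' : (0 : ℝ) < K := by exact_mod_cast hK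
  have hη0 : 0 < R.η := by rw [hη]; positivity
  refine ⟨fun k hk =>
    (h.memLp_gradient_avgIterate hL hv hk.le).integrable_norm_pow two_ne_zero, ?_⟩
  rcases lt_or_ge ρ 1 with hρ1 | hρ1
  · have hρ0 : 0 ≤ ρ := hρ ▸ norm_nonneg _
    have hsq : √ρ < 1 := by
      rw [Real.sqrt_lt' one_pos]
      linarith
    have hcons : ∀ k < K, ∫ ω, R.consensusError N k ω ∂μ ≤ R.η ^ 2 * m * max C 0 := fun k hk =>
      (h.integral_consensusError_le hL hu hv hζ hη0.le (hρ.trans_le hρ1.le)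
        (by rw [hρ]; exact hrate.sqrt_mul_le hρ0) (by linarith) hk.le).trans
        (mul_le_mul_of_nonneg_left (le_max_left _ _) (by positivity))
    refine (h.average_norm_gradient_sq_le hL hu hv hη0 hrate.1 hF (hΔ.trans (le_max_left Δ 0))
      hK hcons).trans (le_of_eq ?_)
    have e1 : R.η * K = √(m * K) := by
      rw [hη, Real.sqrt_div hm.le, Real.sqrt_mul hm.le]
      nth_rewrite 2 [← Real.mul_self_sqrt hK'.le]
      field_simp
    have e2 : R.η / m = 1 / √(m * K) := by
      rw [hη, Real.sqrt_div hm.le, Real.sqrt_mul hm.le]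
      nth_rewrite 2 [← Real.mul_self_sqrt hm.le]
      field_simp
    have e3 : R.η ^ 2 = m / K := by rw [hη, Real.sq_sqrt (by positivity)]
    rw [e1, e2, e3]
    ring
  · -- the objective is affine and bounded below, hence constant
    have hL0 : L = 0 := hrate.eq_zero hη0 hρ1
    have hgrad : ∀ x, gradient P.obj x = 0 := gradient_eq_zero_of_lipschitzWith_zero
      hL.differentiable_obj (hL0 ▸ hL.lipschitzWith_gradient_obj) hF
    simp only [hgrad, norm_zero, ne_eq, OfNat.ofNat_ne_zero, not_false_eq_true, zero_pow,
      integral_zero, Finset.sum_const_zero, mul_zero]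
    positivity
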